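/- Let $p>3$ be a prime and let $x\in\mathbb{Z}_p$ be a $p$-adic integer with $x\neq -1/2$. For a nonnegative integer $n$ set $$s_n(x)=\sum_{k=0}^n\binom{n}{k}\binom{x}{k}\binom{x+k}{k},\qquad\text{where } \binom{y}{k}=\frac{y(y-1)\cdots(y-k+1)}{k!},$$ and let $\langle x\rangle_p$ denote the least nonnegative residue of $x$ modulo $p$, i.e. the unique integer $r\in\{0,1,\ldots,p-1\}$ with $x-r\in p\mathbb{Z}_p$. Then $$\sum_{n=0}^{p-1}s_n(x)^2\equiv(-1)^{\langle x\rangle_p}\,\frac{p+2\,(x-\langle x\rangle_p)}{2x+1}\pmod{p^3},$$ that is, the difference of the two sides, computed in $\mathbb{Q}_p$, lies in $p^3\mathbb{Z}_p$. -/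

import Mathlib

/-- The dual sequence `s_n(x) = ∑_{k=0}^n C(n,k) C(x,k) C(x+k,k)` at a `p`-adic integer `x`.
`Ring.choose x k` is the generalized binomial coefficient `x (x-1) ⋯ (x-k+1) / k!`,
which lies in `ℤ_[p]` when `x` does. -/
noncomputable def dualSeq {p : ℕ} [Fact p.Prime] (n : ℕ) (x : ℤ_[p]) : ℤ_[p] :=
  ∑ k ∈ Finset.range (n + 1),
    (n.choose k : ℤ_[p]) * Ring.choose x k * Ring.choose (x + (k : ℤ_[p])) k

/-- `⟨x⟩_p`: the least nonnegative residue of the `p`-adic integer `x` modulo `p`. -/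
noncomputable def leastResidue {p : ℕ} [Fact p.Prime] (x : ℤ_[p]) : ℕ :=
  x.zmodRepr

/-- Congruence modulo `p ^ r` of `p`-adic numbers: the difference is `p ^ r` times a
`p`-adic integer. -/
def PadicCongr {p : ℕ} [Fact p.Prime] (r : ℕ) (a b : ℚ_[p]) : Prop :=
  ∃ c : ℤ_[p], a - b = (p : ℚ_[p]) ^ r * (c : ℚ_[p])

/-! As a function of `λ = x (x + 1)`, the sum `s_n(x)` is a polynomial of degree `n`. These
polynomials are continuous dual Hahn polynomials, so they satisfy a three-term recurrence in `n`
(`nextDualPoly_succ`), and the confluent Christoffel–Darboux formula (`sum_dualPoly_sq`) evaluates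
`∑_{n<p} s_n²` as `p² (s_p' s_{p-1} - s_p s_{p-1}')`, with derivatives taken in `λ`. All terms of
`s_p` but the first and the last are divisible by `p`, and `(p-1)!² p²` times the last one is
`P(λ) = ∏_{i<p} (λ - i (i + 1))`. Hence, modulo `p³` (`exists_sum_dualPoly_sq_eq`), `(p-1)!²
∑_{n<p} s_n² ≡ P' s_{p-1} - (P + (p-1)!² p²) s_{p-1}'`.

It remains to know `s_{p-1}` and `P` near the residue `r` of `x`. Write `x = r + p t`. For fixed
`n` the sequence also satisfies a second-order difference equation in `x` (`dualSeq_shift`).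
Starting from the Wolstenholme-type congruence `s_{p-1}(p t) ≡ 1`, it gives `s_{p-1}(r + p t)`
modulo `p³` (`toZModPow_dualSeq_natCast_add`): this is `∏_{1≤i≤r} (p - i) / (p + i)` times a
factor congruent to `1` modulo `p²`. On the other side, `P(X (X + 1)) = (X - r) (X + p - r) O(X)`,
where `O(r)` is exactly `(-1)^r (p-1)!² ∏_{1≤i≤r} (p + i) / (p - i)` and `O'(r) ≡ 0 (mod p)`,
since `O ≡ ((X - r)^{p-1} - 1)²`.

If `p ∤ 2 x + 1`, comparing `s_{p-1}` at `x` and `x + p` gives `s_{p-1}' ≡ 0 (mod p)`. The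
products in `s_{p-1}` and `O(r)` cancel, and `(2 x + 1) ∑ s_n² ≡ (-1)^r (p + 2 p t)`. If `p ∣ 2 x
+ 1`, then `r = (p - 1) / 2`, the quotient on the right is `1`, and the `p²`-term of `s_{p-1}` is
cancelled by the one coming from `s_{p-1}'`; here `p > 3` is needed for the second-order vanishing
of `P`. -/

/-! ### The summands and the difference equation in `x` -/

section DualSequence

open Finset

variable {p : ℕ} [Fact p.Prime]

/-- The summand `C(x,k) C(x+k,k)` of the dual sequence. -/
noncomputable def binomPair (x : ℤ_[p]) (k : ℕ) : ℤ_[p] :=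
  Ring.choose x k * Ring.choose (x + (k : ℤ_[p])) k

theorem dualSeq_eq_sum (n : ℕ) (x : ℤ_[p]) :
    dualSeq n x = ∑ k ∈ range (n + 1), (n.choose k : ℤ_[p]) * binomPair x k := by
  simp only [dualSeq, binomPair, mul_assoc]

theorem succ_mul_ringChoose_succ (x : ℤ_[p]) (k : ℕ) :
    ((k : ℤ_[p]) + 1) * Ring.choose x (k + 1) = (x - (k : ℤ_[p])) * Ring.choose x k := by
  have h := Ring.choose_smul_choose x (n := k + 1) (k := k) (Nat.le_succ k)
  rw [Nat.choose_succ_self_right, Nat.add_sub_cancel_left, Ring.choose_one_right,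
    nsmul_eq_mul] at h
  push_cast at h
  rw [h, mul_comm]

theorem succ_mul_ringChoose_add_succ (x : ℤ_[p]) (k : ℕ) :
    ((k : ℤ_[p]) + 1) * Ring.choose (x + (k + 1 : ℕ)) (k + 1)
      = (x + (k : ℤ_[p]) + 1) * Ring.choose (x + (k : ℤ_[p])) k := by
  have h1 := succ_mul_ringChoose_succ (x + (k : ℤ_[p])) k
  have h2 := Ring.choose_succ_succ (x + (k : ℤ_[p])) k
  push_cast
  rw [← add_assoc, h2]
  linear_combination h1

@[simp]
theorem binomPair_zero (x : ℤ_[p]) : binomPair x 0 = 1 := by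
  simp [binomPair]

/-- `binomPair x k` depends on `x` only through `x (x + 1)`. -/
theorem binomPair_succ (x : ℤ_[p]) (k : ℕ) :
    ((k : ℤ_[p]) + 1) ^ 2 * binomPair x (k + 1)
      = (x * (x + 1) - (k : ℤ_[p]) * (k + 1)) * binomPair x k := by
  have h1 := succ_mul_ringChoose_succ x k
  have h2 := succ_mul_ringChoose_add_succ x k
  unfold binomPair
  linear_combination ((k : ℤ_[p]) + 1) * Ring.choose (x + (k + 1 : ℕ)) (k + 1) * h1
    + (x - k) * Ring.choose x k * h2

theorem natCast_succ_sq_ne_zero (k : ℕ) : ((k : ℤ_[p]) + 1) ^ 2 ≠ 0 :=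
  pow_ne_zero _ (by exact_mod_cast Nat.succ_ne_zero k)

theorem binomPair_neg_one_sub (x : ℤ_[p]) (k : ℕ) : binomPair (-1 - x) k = binomPair x k := by
  induction k with
  | zero => simp
  | succ k ih =>
    apply mul_left_cancel₀ (natCast_succ_sq_ne_zero k)
    rw [binomPair_succ, binomPair_succ, ih]
    ring

/-- The factor `x + 1 - k` common to both sides of the naive relation between `binomPair (x + 1)`
and `binomPair x` is avoided by shifting `k` as well. -/
theorem binomPair_add_one (x : ℤ_[p]) (k : ℕ) :
    ((k : ℤ_[p]) + 1) ^ 2 * binomPair (x + 1) (k + 1)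
      = (x + 1 + (k : ℤ_[p])) * (x + 2 + (k : ℤ_[p])) * binomPair x k := by
  induction k with
  | zero =>
    have h := binomPair_succ (x + 1) 0
    simp only [binomPair_zero] at h ⊢
    push_cast at h ⊢
    linear_combination h
  | succ k ih =>
    apply mul_left_cancel₀ (natCast_succ_sq_ne_zero k)
    have h := binomPair_succ (x + 1) (k + 1)
    have h' := binomPair_succ x k
    push_cast at h ⊢
    linear_combination ((k : ℤ_[p]) + 1) ^ 2 * h + (x - k) * (x + 3 + k) * ih
      - (x + 2 + k) * (x + 3 + k) * h'

theorem binomPair_sub_one (x : ℤ_[p]) (k : ℕ) :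
    ((k : ℤ_[p]) + 1) ^ 2 * binomPair (x - 1) (k + 1)
      = (x - (k : ℤ_[p])) * (x - 1 - (k : ℤ_[p])) * binomPair x k := by
  have h := binomPair_add_one (-1 - x) k
  rw [show -1 - x + 1 = -1 - (x - 1) by ring, binomPair_neg_one_sub, binomPair_neg_one_sub] at h
  linear_combination h

theorem dualSeq_neg_one_sub (n : ℕ) (x : ℤ_[p]) : dualSeq n (-1 - x) = dualSeq n x := by
  simp only [dualSeq_eq_sum, binomPair_neg_one_sub]

/-- Partial sums of the difference equation telescope: with `g k = (n - k) C(n,k) binomPair x k`,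
the `k`-th summand is `2 (2 x + 1) (g (k - 1) - g k)`, and `g n = 0`. -/
theorem dualSeq_shift_partial_sum (n : ℕ) (x : ℤ_[p]) (m : ℕ) :
    ∑ k ∈ range (m + 1), (n.choose k : ℤ_[p]) * ((x + 1) ^ 2 * binomPair (x + 1) k
        - x ^ 2 * binomPair (x - 1) k - (2 * x + 1) * (2 * (n : ℤ_[p]) + 1) * binomPair x k)
      = -(2 * (2 * x + 1) * ((n : ℤ_[p]) - m) * n.choose m * binomPair x m) := by
  induction m with
  | zero => simp; ring
  | succ m ih =>
    rw [sum_range_succ, ih]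
    apply mul_left_cancel₀ (natCast_succ_sq_ne_zero m)
    have hc : ((n.choose (m + 1) : ℕ) : ℤ_[p]) * (m + 1) = n.choose m * (n - m) := by
      rcases le_or_gt m n with h | h
      · have := Nat.choose_succ_right_eq n m
        rw [← Nat.cast_sub h]
        exact_mod_cast this
      · simp [Nat.choose_eq_zero_of_lt h, Nat.choose_eq_zero_of_lt (Nat.lt_succ_of_lt h)]
    have h1 := binomPair_add_one x m
    have h2 := binomPair_sub_one x m
    have h3 := binomPair_succ x m
    push_cast
    linear_combination (n.choose (m + 1) : ℤ_[p]) * (x + 1) ^ 2 * h1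
      - (n.choose (m + 1) : ℤ_[p]) * x ^ 2 * h2
      - (n.choose (m + 1) : ℤ_[p]) * (2 * x + 1) * (2 * (n : ℤ_[p]) + 1) * h3
      + 2 * (2 * x + 1) * (n - (m + 1)) * n.choose (m + 1) * h3
      + 2 * (2 * x + 1) * (m + 1) ^ 2 * binomPair x m * hc

/-- The difference equation in `x` satisfied by the dual sequence. -/
theorem dualSeq_shift (n : ℕ) (x : ℤ_[p]) :
    (x + 1) ^ 2 * dualSeq n (x + 1) - x ^ 2 * dualSeq n (x - 1)
      = (2 * x + 1) * (2 * (n : ℤ_[p]) + 1) * dualSeq n x := by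
  have h := dualSeq_shift_partial_sum n x n
  rw [sub_self, mul_zero, zero_mul, zero_mul, neg_zero] at h
  simp only [dualSeq_eq_sum, mul_sum]
  rw [← sub_eq_zero, ← h, ← sum_sub_distrib, ← sum_sub_distrib]
  exact sum_congr rfl fun k _ => by ring

end DualSequence

/-! ### Truncated expansion modulo the cube of a parameter -/

section TruncatedExpansion

open Finset

variable {R : Type*} [CommRing R]

/-- Modulo `π ^ 3`, a sum of the shape `∑ C(π - 1, k) C(z, k) C(z + k, k)` with `π ∣ z` only
involves the harmonic sums of orders one and two. -/
theorem two_mul_sum_eq_harmonic {π t : R} (h3 : π ^ 3 = 0) {N : ℕ} {u q P : ℕ → R}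
    (hu : ∀ k < N, ((k : R) + 1) * u k = 1) (hq0 : q 0 = 1) (hP0 : P 0 = 1)
    (hq : ∀ k : ℕ, ((k : R) + 1) * q (k + 1) = (π - (k + 1)) * q k)
    (hP : ∀ k : ℕ, ((k : R) + 1) ^ 2 * P (k + 1) = (π * t * (π * t + 1) - k * (k + 1)) * P k)
    (K : ℕ) (hK : K ≤ N) :
    2 * ∑ k ∈ range (K + 1), q k * P k
      = 2 - 2 * (π * t) * ∑ k ∈ range K, u k - 2 * (π * t) ^ 2 * ∑ k ∈ range K, u k ^ 2
        + π * (π * t) * ((∑ k ∈ range K, u k) ^ 2 + ∑ k ∈ range K, u k ^ 2) := by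
  -- `C(π - 1, k)` modulo `π ^ 2`.
  have hq' : ∀ k ≤ N, π * q k = π * ((-1) ^ k * (1 - π * ∑ j ∈ range k, u j)) := by
    intro k
    induction k with
    | zero => simp [hq0]
    | succ k ih =>
      intro hk
      have h1 := ih (by omega)
      have h2 := hq k
      have h4 := hu k (by omega)
      rw [sum_range_succ, pow_succ]
      generalize (∑ j ∈ range k, u j) = H at *
      generalize ((-1 : R) ^ k) = s at *
      generalize q (k + 1) = q' at *
      generalize u k = v at *
      generalize q k = q0 at *
      generalize (k : R) = κ at *
      have h5 : q' = v * ((π - (κ + 1)) * q0) := by linear_combination v * h2 - q' * h4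
      rw [h5]
      grind
  -- `C(z, k) C(z + k, k)` modulo `π ^ 3`; each factor `z² - j²` reduces to `-j²` next to `z`.
  have hP' : ∀ k < N, P (k + 1) = (-1) ^ k * (π * t) * (π * t + k + 1) * u k ^ 2 := by
    intro k
    induction k with
    | zero =>
      intro hk
      have h1 := hP 0
      have h2 := hu 0 hk
      simp only [hP0, Nat.cast_zero, zero_add] at *
      have h5 : u 0 = 1 := by linear_combination h2
      rw [h5]
      linear_combination h1
    | succ k ih =>
      intro hk
      have h1 := ih (by omega)
      have h2 := hP (k + 1)
      have h4 := hu k (by omega)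
      have h5 := hu (k + 1) (by omega)
      push_cast at *
      rw [h1] at h2
      rw [pow_succ]
      generalize ((-1 : R) ^ k) = s at *
      generalize P (k + 1 + 1) = q' at *
      generalize u k = v at *
      generalize u (k + 1) = w at *
      generalize (k : R) = κ at *
      have h6 : q' = w ^ 2 * ((κ + 1 + 1) ^ 2 * q') := by
        linear_combination (-(w * (κ + 1 + 1)) * q' - q') * h5
      rw [h6, h2]
      grind
  induction K with
  | zero => simp [hq0, hP0]
  | succ K ih =>
    have h1 := ih (by omega)
    have h2 := hq' (K + 1) hK
    have h4 := hP' K (by omega)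
    have h5 := hu K (by omega)
    rw [sum_range_succ, mul_add, h1, h4]
    rw [sum_range_succ, pow_succ] at h2
    simp only [sum_range_succ u, sum_range_succ (fun k => u k ^ 2)]
    have hs : ((-1 : R) ^ K) * (-1) ^ K = 1 := by rw [← mul_pow]; simp
    generalize (∑ j ∈ range K, u j) = H at *
    generalize (∑ j ∈ range K, u j ^ 2) = B at *
    generalize ((-1 : R) ^ K) = s at *
    generalize q (K + 1) = q' at *
    generalize u K = v at *
    generalize (K : R) = κ at *
    -- The factor `π` contained in `P (K + 1)` makes `q (K + 1)` matter modulo `π ^ 2` only.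
    have h6 : q' * (s * (π * t) * (π * t + κ + 1) * v ^ 2)
        = s * t * (π * t + κ + 1) * v ^ 2 * (π * (s * -1 * (1 - π * (H + v)))) := by
      linear_combination (s * t * (π * t + κ + 1) * v ^ 2) * h2
    rw [h6]
    clear h6 h4 h2 h1 ih hP' hq' hP hq hu
    grind

end TruncatedExpansion

/-! ### Solving the difference equation modulo the cube of a parameter -/

section ShiftRecurrence

open Finset

variable {R : Type*} [CommRing R]

/-- The polynomial identity behind the induction step of `shift_recurrence_solution`; `a` and `b`
are the inverses of `n` and `n + 1`, and `s` is the sign `(-1) ^ n`. -/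
theorem shift_recurrence_step {π t n a b A B s : R} (h3 : π ^ 3 = 0) (ha : n * a = 1)
    (hb : (n + 1) * b = 1) :
    (n + π * t) ^ 2 * (π + n) * (π + n + 1) * (1 + 2 * A * (π ^ 2 + (π * t) ^ 2)
        + 2 * π * (π * t) * (A + B))
      + (2 * n + 1 + 2 * (π * t)) * (2 * π - 1) * (π + n + 1) * (π - n)
        * (1 + 2 * (A + s * a ^ 2) * (π ^ 2 + (π * t) ^ 2)
          + 2 * π * (π * t) * (A + s * a ^ 2 + (B + a ^ 2)))
      = (n + 1 + π * t) ^ 2 * (π - n) * (π - (n + 1))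
        * (1 + 2 * (A + s * a ^ 2 - s * b ^ 2) * (π ^ 2 + (π * t) ^ 2)
          + 2 * π * (π * t) * (A + s * a ^ 2 - s * b ^ 2 + (B + a ^ 2 + b ^ 2))) := by
  grind

/-- Modulo `π ^ 3`, the solution of the difference equation
`(x + 1) ^ 2 f (x + 1) - x ^ 2 f (x - 1) = (2 x + 1) (2 π - 1) f x` along `x = r + π t`, normalised
by `f = 1` at both `x = π t` and `x = π t - 1`. -/
theorem shift_recurrence_solution {π t : R} (h3 : π ^ 3 = 0) {N : ℕ} {u f : ℕ → R}
    (hu : ∀ k < N, ((k : R) + 1) * u k = 1) (hf0 : f 0 = 1)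
    (hf1 : (1 + π * t) ^ 2 * f 1 = (π * t) ^ 2 + (1 + 2 * (π * t)) * (2 * π - 1))
    (hf : ∀ r : ℕ, ((r : R) + 2 + π * t) ^ 2 * f (r + 2)
      = (r + 1 + π * t) ^ 2 * f r + (2 * (r + 1) + 1 + 2 * (π * t)) * (2 * π - 1) * f (r + 1))
    (r : ℕ) (hr : r ≤ N) :
    f r * ∏ i ∈ range r, (π + (i + 1))
      = (∏ i ∈ range r, (π - (i + 1)))
        * (1 + 2 * (∑ i ∈ range r, (-1) ^ (i + 1) * u i ^ 2) * (π ^ 2 + (π * t) ^ 2)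
          + 2 * π * (π * t)
            * (∑ i ∈ range r, (-1) ^ (i + 1) * u i ^ 2 + ∑ i ∈ range r, u i ^ 2)) := by
  have hunit : ∀ k < N, IsUnit (((k : R) + 1 + π * t) ^ 2) := by
    intro k hk
    refine IsUnit.pow 2 ?_
    have hn : IsNilpotent (π * t) := ⟨3, by rw [mul_pow, h3, zero_mul]⟩
    exact hn.isUnit_add_left_of_commute (IsUnit.of_mul_eq_one _ (hu k hk)) (Commute.all _ _)
  induction r using Nat.twoStepInduction with
  | zero => simp [hf0]
  | one =>
    apply (hunit 0 hr).mul_left_cancel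
    have h0 := hu 0 hr
    simp only [range_one, prod_singleton, sum_singleton, Nat.cast_zero, zero_add, pow_one] at *
    have h5 : u 0 = 1 := by linear_combination h0
    rw [h5, ← mul_assoc, hf1]
    clear hf1 h0 h5 hf hu hunit hf0
    grind
  | more r ih1 ih2 =>
    have h1 := ih1 (by omega)
    have h2 := ih2 (by omega)
    have h4 := hu r (by omega)
    have h5 := hu (r + 1) (by omega)
    have h6 := hf r
    have key := shift_recurrence_step (t := t) (A := ∑ i ∈ range r, (-1) ^ (i + 1) * u i ^ 2)
      (B := ∑ i ∈ range r, u i ^ 2) (s := (-1) ^ (r + 1)) h3 h4 (by push_cast at h5; exact h5)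
    apply (hunit (r + 1) hr).mul_left_cancel
    simp only [sum_range_succ, prod_range_succ] at *
    push_cast at *
    rw [pow_succ (-1 : R) (r + 1)]
    linear_combination (∏ i ∈ range r, (π + ((i : R) + 1))) * (π + (r + 1)) * (π + (r + 1 + 1)) * h6
      + (r + 1 + π * t) ^ 2 * (π + (r + 1)) * (π + (r + 1 + 1)) * h1
      + (2 * ((r : R) + 1) + 1 + 2 * (π * t)) * (2 * π - 1) * (π + (r + 1 + 1)) * h2
      + (∏ i ∈ range r, (π - ((i : R) + 1))) * key

end ShiftRecurrence

section Wolstenholme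

open Finset

variable {R : Type*} [CommRing R]

/-- Pairing `k` with `p - k` turns the first-order harmonic sum into a second-order one. -/
theorem two_mul_harmonic_eq_zero {p : ℕ} (h3 : (p : R) ^ 3 = 0) {u : ℕ → R}
    (hu : ∀ k < p - 1, ((k : R) + 1) * u k = 1)
    (hB : (p : R) ^ 2 * ∑ k ∈ range (p - 1), u k ^ 2 = 0) :
    2 * ((p : R) * ∑ k ∈ range (p - 1), u k) = 0 := by
  have hpair : ∀ k ∈ range (p - 1),
      (p : R) * (u k + u (p - 1 - 1 - k)) = -((p : R) ^ 2 * u k ^ 2) := by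
    intro k hk
    have hk' := mem_range.mp hk
    have h1 := hu k hk'
    have h2 := hu (p - 1 - 1 - k) (by omega)
    have h4 : (p : R) = (k + 1) + (((p - 1 - 1 - k : ℕ) : R) + 1) := by
      rw [show (p : R) = ((k + 1 + (p - 1 - 1 - k + 1) : ℕ) : R) by congr 1; omega]
      push_cast; ring
    generalize ((p - 1 - 1 - k : ℕ) : R) = l at *
    generalize u (p - 1 - 1 - k) = v at *
    generalize u k = w at *
    generalize (p : R) = π at *
    have h6 : w + v = π * w * v := by
      rw [h4]; linear_combination -v * h1 - w * h2
    linear_combination (π + π ^ 2 * w) * h6 + w ^ 2 * v * h3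
  have h := sum_congr rfl hpair
  rw [← mul_sum, sum_add_distrib, sum_range_reflect u (p - 1), sum_neg_distrib, ← mul_sum, hB] at h
  linear_combination h

end Wolstenholme

/-! ### Residue rings of `ℤ_[p]` and values of `s_{p-1}` modulo `p ^ 3` -/

section ResidueRings

open Finset

theorem ZMod.prod_range_natCast {M : Type*} [CommMonoid M] (p : ℕ) [NeZero p] (g : ZMod p → M) :
    ∏ k ∈ range p, g (k : ZMod p) = ∏ a : ZMod p, g a :=
  prod_nbij' (fun k => (k : ZMod p)) ZMod.val (fun _ _ => mem_univ _)
    (fun a _ => mem_range.mpr (ZMod.val_lt a))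
    (fun _ hk => ZMod.val_cast_of_lt (mem_range.mp hk))
    (fun a _ => ZMod.natCast_zmod_val a) (fun _ _ => rfl)

theorem ZMod.sum_range_natCast {M : Type*} [AddCommMonoid M] (p : ℕ) [NeZero p]
    (g : ZMod p → M) : ∑ k ∈ range p, g (k : ZMod p) = ∑ a : ZMod p, g a :=
  ZMod.prod_range_natCast (M := Multiplicative M) p g

theorem ZMod.sum_inv_sq_eq_zero {p : ℕ} [Fact p.Prime] (hp : 3 < p) :
    ∑ a : ZMod p, a⁻¹ ^ 2 = 0 := by
  refine (Equiv.sum_comp (Equiv.inv (ZMod p)) (fun a => a ^ 2)).trans ?_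
  exact FiniteField.sum_pow_lt_card_sub_one _ 2 (by rw [ZMod.card]; omega)

variable {p : ℕ} [Fact p.Prime]

theorem PadicInt.toZMod_eq_zero_iff (x : ℤ_[p]) : PadicInt.toZMod x = 0 ↔ (p : ℤ_[p]) ∣ x := by
  rw [← RingHom.mem_ker, PadicInt.ker_toZMod, PadicInt.maximalIdeal_eq_span_p,
    Ideal.mem_span_singleton]

theorem PadicInt.toZModPow_eq_zero_iff (n : ℕ) (x : ℤ_[p]) :
    PadicInt.toZModPow n x = 0 ↔ (p : ℤ_[p]) ^ n ∣ x := by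
  rw [← RingHom.mem_ker, PadicInt.ker_toZModPow, Ideal.mem_span_singleton]

theorem PadicInt.toZModPow_eq_iff (n : ℕ) (x y : ℤ_[p]) :
    PadicInt.toZModPow n x = PadicInt.toZModPow n y ↔ (p : ℤ_[p]) ^ n ∣ x - y := by
  rw [← PadicInt.toZModPow_eq_zero_iff, map_sub, sub_eq_zero]

theorem PadicInt.isUnit_iff_not_dvd (x : ℤ_[p]) : IsUnit x ↔ ¬ (p : ℤ_[p]) ∣ x := by
  rw [← PadicInt.norm_lt_one_iff_dvd, ← PadicInt.not_isUnit_iff, not_not]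

theorem PadicInt.isUnit_natCast_of_lt {k : ℕ} (h0 : k ≠ 0) (hk : k < p) :
    IsUnit (k : ℤ_[p]) := by
  rw [PadicInt.isUnit_iff_not_dvd, ← PadicInt.toZMod_eq_zero_iff, map_natCast,
    ZMod.natCast_eq_zero_iff]
  exact fun h => hk.not_ge (Nat.le_of_dvd (Nat.pos_of_ne_zero h0) h)

theorem PadicInt.isUnit_natCast_succ {k : ℕ} (hk : k < p - 1) : IsUnit ((k : ℤ_[p]) + 1) := by
  exact_mod_cast PadicInt.isUnit_natCast_of_lt (p := p) k.succ_ne_zero (by omega)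

/-- The inverse of `k + 1` in `ℤ_[p]`; it has the junk value `0` when `p ∣ k + 1`. -/
noncomputable def succInv (p : ℕ) [Fact p.Prime] (k : ℕ) : ℤ_[p] :=
  Ring.inverse ((k : ℤ_[p]) + 1)

theorem succ_mul_succInv {k : ℕ} (hk : k < p - 1) : ((k : ℤ_[p]) + 1) * succInv p k = 1 :=
  Ring.mul_inverse_cancel _ (PadicInt.isUnit_natCast_succ hk)

/-- The sum is that of all squares of `ZMod p`; it vanishes as soon as `2 < p - 1`. -/
theorem dvd_sum_succInv_sq (hp : 3 < p) :
    (p : ℤ_[p]) ∣ ∑ k ∈ range (p - 1), succInv p k ^ 2 := by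
  rw [← PadicInt.toZMod_eq_zero_iff, map_sum, ← ZMod.sum_inv_sq_eq_zero hp,
    ← ZMod.sum_range_natCast p (fun a => a⁻¹ ^ 2)]
  have hr : range p = range ((p - 1) + 1) := by congr 1; omega
  rw [hr, sum_range_succ']
  simp only [Nat.cast_zero, inv_zero, ne_eq, OfNat.ofNat_ne_zero, not_false_eq_true, zero_pow,
    add_zero]
  refine sum_congr (by simp) fun k hk => ?_
  rw [map_pow]
  congr 1
  refine eq_inv_of_mul_eq_one_right ?_
  have h := congrArg PadicInt.toZMod (succ_mul_succInv (p := p) (mem_range.mp hk))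
  rw [map_mul, map_one, map_add, map_natCast, map_one] at h
  push_cast
  exact h

end ResidueRings

section LastTerm

open Finset

theorem natCast_pow_three_eq_zero (n : ℕ) : (n : ZMod (n ^ 3)) ^ 3 = 0 := by
  rw [← Nat.cast_pow, ZMod.natCast_self]

variable {p : ℕ} [Fact p.Prime]

theorem toZModPow_succ_mul_succInv {k : ℕ} (hk : k < p - 1) :
    ((k : ZMod (p ^ 3)) + 1) * PadicInt.toZModPow 3 (succInv p k) = 1 := by
  rw [← map_natCast (PadicInt.toZModPow (p := p) 3), ← map_one (PadicInt.toZModPow (p := p) 3),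
    ← map_add, ← map_mul, succ_mul_succInv hk]

theorem isUnit_two_zmod (hp : 3 < p) : IsUnit (2 : ZMod (p ^ 3)) := by
  have := (PadicInt.isUnit_natCast_of_lt (p := p) two_ne_zero (by omega)).map
    (PadicInt.toZModPow (p := p) 3)
  rwa [map_natCast] at this

theorem succ_mul_choose_pred (k : ℕ) :
    ((k : ZMod (p ^ 3)) + 1) * ((p - 1).choose (k + 1) : ℕ)
      = (p - ((k : ZMod (p ^ 3)) + 1)) * ((p - 1).choose k : ℕ) := by
  have hp := (Fact.out : p.Prime).pos
  rcases le_or_gt k (p - 1) with h | h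
  · have h1 := Nat.choose_succ_right_eq (p - 1) k
    have h2 := congrArg (Nat.cast : ℕ → ZMod (p ^ 3)) h1
    push_cast [Nat.cast_sub h, Nat.cast_sub (show 1 ≤ p from hp)] at h2
    linear_combination h2
  · simp [Nat.choose_eq_zero_of_lt h, Nat.choose_eq_zero_of_lt (Nat.lt_succ_of_lt h)]

/-- A Wolstenholme-type congruence: `s_{p-1}(z) ≡ 1 (mod p ^ 3)` when `p ∣ z`. -/
theorem toZModPow_dualSeq_mul_eq_one (hp : 3 < p) (t : ℤ_[p]) :
    PadicInt.toZModPow 3 (dualSeq (p - 1) ((p : ℤ_[p]) * t)) = 1 := by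
  set φ := PadicInt.toZModPow (p := p) 3
  have h3 := natCast_pow_three_eq_zero p
  have hB : (p : ZMod (p ^ 3)) ^ 2 * ∑ k ∈ range (p - 1), φ (succInv p k) ^ 2 = 0 := by
    obtain ⟨c, hc⟩ := dvd_sum_succInv_sq hp
    simp only [← map_pow, ← map_sum]
    rw [hc, map_mul, map_natCast]
    linear_combination φ c * h3
  -- `p` times the harmonic sum vanishes, so that the harmonic sum itself is divisible by `p ^ 2`.
  have hH := (isUnit_two_zmod hp).mul_left_cancel
    ((two_mul_harmonic_eq_zero h3 (fun _ => toZModPow_succ_mul_succInv) hB).trans (mul_zero 2).symm)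
  have h := two_mul_sum_eq_harmonic (t := φ t) h3
    (fun k hk => toZModPow_succ_mul_succInv (p := p) (k := k) hk)
    (q := fun k => ((p - 1).choose k : ZMod (p ^ 3)))
    (P := fun k => φ (binomPair ((p : ℤ_[p]) * t) k)) (by simp) (by simp)
    succ_mul_choose_pred (fun k => by
      have := congrArg φ (binomPair_succ ((p : ℤ_[p]) * t) k)
      simpa only [map_mul, map_pow, map_add, map_sub, map_natCast, map_one] using this)
    (p - 1) le_rfl
  apply (isUnit_two_zmod hp).mul_left_cancel
  rw [dualSeq_eq_sum, map_sum]
  simp only [map_mul, map_natCast]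
  rw [h]
  linear_combination (-2 * φ t
      + (p : ZMod (p ^ 3)) * φ t * ∑ k ∈ range (p - 1), φ (succInv p k)) * hH
    + (-2 * φ t ^ 2 + φ t) * hB

/-- The factor `1 + 2 A (p² + z²) + 2 p z (A + B)` with `z = p t`, where `A = ∑_{j≤r} (-1)^j / j²`
and `B = ∑_{j≤r} 1 / j²`. It measures how far `s_{p-1}(r + z)` is from `∏_{1≤i≤r} (p - i) / (p +
i)` modulo `p ^ 3`. -/
noncomputable def correction (p : ℕ) [Fact p.Prime] (r : ℕ) (t : ZMod (p ^ 3)) : ZMod (p ^ 3) :=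
  1 + 2 * (∑ i ∈ range r, (-1) ^ (i + 1) * PadicInt.toZModPow 3 (succInv p i) ^ 2)
      * ((p : ZMod (p ^ 3)) ^ 2 + (p * t) ^ 2)
    + 2 * p * (p * t) * (∑ i ∈ range r, (-1) ^ (i + 1) * PadicInt.toZModPow 3 (succInv p i) ^ 2
      + ∑ i ∈ range r, PadicInt.toZModPow 3 (succInv p i) ^ 2)

/-- The value of `s_{p-1}` modulo `p ^ 3` at an arbitrary `p`-adic integer `r + p t`. -/
theorem toZModPow_dualSeq_natCast_add (hp : 3 < p) (t : ℤ_[p]) {r : ℕ} (hr : r < p) :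
    PadicInt.toZModPow 3 (dualSeq (p - 1) ((r : ℤ_[p]) + (p : ℤ_[p]) * t))
        * ∏ i ∈ range r, ((p : ZMod (p ^ 3)) + (i + 1))
      = (∏ i ∈ range r, ((p : ZMod (p ^ 3)) - (i + 1)))
        * correction p r (PadicInt.toZModPow 3 t) := by
  set φ := PadicInt.toZModPow (p := p) 3 with hφ
  have h1 := toZModPow_dualSeq_mul_eq_one hp t
  have hshift : ∀ y : ℤ_[p], (φ y + 1) ^ 2 * φ (dualSeq (p - 1) (y + 1))
      - φ y ^ 2 * φ (dualSeq (p - 1) (y - 1))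
      = (2 * φ y + 1) * (2 * p - 1) * φ (dualSeq (p - 1) y) := by
    intro y
    have h := congrArg φ (dualSeq_shift (p - 1) y)
    rw [Nat.cast_sub (Fact.out : p.Prime).one_le] at h
    simp only [map_mul, map_pow, map_add, map_sub, map_natCast, map_one, map_ofNat,
      Nat.cast_one] at h
    linear_combination h
  refine shift_recurrence_solution (t := φ t) (natCast_pow_three_eq_zero p) (N := p - 1)
    (u := fun k => φ (succInv p k))
    (f := fun r : ℕ => φ (dualSeq (p - 1) ((r : ℤ_[p]) + (p : ℤ_[p]) * t)))
    (fun k hk => toZModPow_succ_mul_succInv hk) (by simpa using h1) ?_ ?_ r (by omega)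
  · have h := hshift ((p : ℤ_[p]) * t)
    -- `x ↦ -1 - x` exchanges `p t - 1` and `-p t`.
    have h2 : φ (dualSeq (p - 1) ((p : ℤ_[p]) * t - 1)) = 1 := by
      rw [← dualSeq_neg_one_sub, show -1 - ((p : ℤ_[p]) * t - 1) = p * (-t) by ring]
      exact toZModPow_dualSeq_mul_eq_one hp (-t)
    rw [h1, h2, map_mul, map_natCast] at h
    simp only [Nat.cast_one]
    rw [add_comm (1 : ℤ_[p])]
    linear_combination h
  · intro r
    have h := hshift (((r + 1 : ℕ) : ℤ_[p]) + (p : ℤ_[p]) * t)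
    simp only [map_mul, map_add, map_natCast] at h
    push_cast at h ⊢
    rw [show (r : ℤ_[p]) + 1 + p * t + 1 = r + 2 + p * t by ring,
      show (r : ℤ_[p]) + 1 + p * t - 1 = r + p * t by ring] at h
    linear_combination h

end LastTerm

/-! ### Continuous dual Hahn polynomials and the Christoffel–Darboux formula -/

section ChristoffelDarboux

open Finset Polynomial

variable {p : ℕ} [Fact p.Prime]

/-- The polynomial `∏_{i<k} (X - i (i + 1)) / k!²`, whose value at `x (x + 1)` is `binomPair x k`.
It is meaningful for `k < p`, where it has coefficients in `ℤ_[p]`. -/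
noncomputable def pairPoly (p : ℕ) [Fact p.Prime] : ℕ → ℤ_[p][X]
  | 0 => 1
  | k + 1 => C (succInv p k ^ 2) * ((X - (k : ℤ_[p][X]) * ((k : ℤ_[p][X]) + 1)) * pairPoly p k)

theorem pairPoly_succ {k : ℕ} (hk : k < p - 1) :
    ((k : ℤ_[p][X]) + 1) ^ 2 * pairPoly p (k + 1)
      = (X - (k : ℤ_[p][X]) * ((k : ℤ_[p][X]) + 1)) * pairPoly p k := by
  have h : ((k : ℤ_[p][X]) + 1) * C (succInv p k) = 1 := by
    have := congrArg C (succ_mul_succInv hk)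
    rwa [map_mul, map_add, map_natCast, map_one] at this
  rw [pairPoly, map_pow]
  linear_combination (X - (k : ℤ_[p][X]) * ((k : ℤ_[p][X]) + 1)) * pairPoly p k
    * (((k : ℤ_[p][X]) + 1) * C (succInv p k) + 1) * h

theorem eval_pairPoly (x : ℤ_[p]) {k : ℕ} (hk : k < p) :
    (pairPoly p k).eval (x * (x + 1)) = binomPair x k := by
  induction k with
  | zero => simp [pairPoly]
  | succ k ih =>
    apply mul_left_cancel₀ (natCast_succ_sq_ne_zero k)
    have h := congrArg (eval (x * (x + 1))) (pairPoly_succ (p := p) (k := k) (by omega))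
    simp only [eval_mul, eval_pow, eval_add, eval_sub, eval_natCast, eval_one, eval_X,
      ih (by omega)] at h
    rw [h, binomPair_succ]

theorem factorial_sq_mul_pairPoly {k : ℕ} (hk : k < p) :
    ((k.factorial : ℕ) : ℤ_[p][X]) ^ 2 * pairPoly p k
      = ∏ i ∈ range k, (X - (i : ℤ_[p][X]) * ((i : ℤ_[p][X]) + 1)) := by
  induction k with
  | zero => simp [pairPoly]
  | succ k ih =>
    have h := pairPoly_succ (p := p) (k := k) (by omega)
    rw [prod_range_succ, ← ih (by omega), Nat.factorial_succ]
    push_cast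
    linear_combination (k.factorial : ℤ_[p][X]) ^ 2 * h

/-- The dual sequence as a polynomial in `x (x + 1)`, for `n < p`. -/
noncomputable def dualPoly (p : ℕ) [Fact p.Prime] (n : ℕ) : ℤ_[p][X] :=
  ∑ k ∈ range (n + 1), (n.choose k : ℤ_[p][X]) * pairPoly p k

/-- The polynomial `(n + 1)² s_{n+1}`, written so that it makes sense in `ℤ_[p][X]` for `n = p - 1`
as well. -/
noncomputable def nextDualPoly (p : ℕ) [Fact p.Prime] (n : ℕ) : ℤ_[p][X] :=
  ((n : ℤ_[p][X]) + 1) ^ 2 * ∑ k ∈ range (n + 1), ((n + 1).choose k : ℤ_[p][X]) * pairPoly p k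
    + (X - (n : ℤ_[p][X]) * ((n : ℤ_[p][X]) + 1)) * pairPoly p n

theorem eval_dualPoly (x : ℤ_[p]) {n : ℕ} (hn : n < p) :
    (dualPoly p n).eval (x * (x + 1)) = dualSeq n x := by
  rw [dualPoly, dualSeq_eq_sum, eval_finsetSum]
  refine sum_congr rfl fun k hk => ?_
  rw [eval_mul, eval_natCast, eval_pairPoly x (by have := mem_range.mp hk; omega)]

theorem nextDualPoly_eq {n : ℕ} (hn : n < p - 1) :
    nextDualPoly p n = ((n : ℤ_[p][X]) + 1) ^ 2 * dualPoly p (n + 1) := by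
  rw [dualPoly, sum_range_succ _ (n + 1), nextDualPoly, ← pairPoly_succ hn, Nat.choose_self]
  push_cast
  ring

theorem choose_three_term {R : Type*} [CommRing R] (m k : ℕ) :
    ((m : R) + 2) ^ 2 * ((m + 2).choose (k + 1) : ℕ) + ((m : R) + 1) ^ 2 * (m.choose (k + 1) : ℕ)
      = (2 * ((m : R) + 1) ^ 2 + 2 * (m + 1) + 1 + (k + 1) * (k + 2))
          * ((m + 1).choose (k + 1) : ℕ) + ((k : R) + 1) ^ 2 * ((m + 1).choose k : ℕ) := by
  have h1 : (((m + 2).choose (k + 1) : ℕ) : R)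
      = ((m + 1).choose k : ℕ) + ((m + 1).choose (k + 1) : ℕ) := by
    rw [← Nat.cast_add, ← Nat.choose_succ_succ]
  have h2 : ((m : R) + 1) * (m.choose (k + 1) : ℕ)
      = ((m : R) - k) * ((m + 1).choose (k + 1) : ℕ) := by
    rcases le_or_gt k m with h | h
    · have := congrArg (Nat.cast : ℕ → R) (Nat.choose_mul_succ_eq m (k + 1))
      rw [show m + 1 - (k + 1) = m - k by omega] at this
      push_cast [Nat.cast_sub h] at this
      linear_combination this
    · simp [Nat.choose_eq_zero_of_lt (show m < k + 1 by omega),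
        Nat.choose_eq_zero_of_lt (show m + 1 < k + 1 by omega)]
  have h3 : ((k : R) + 1) * ((m + 1).choose (k + 1) : ℕ)
      = ((m : R) + 1 - k) * ((m + 1).choose k : ℕ) := by
    rcases le_or_gt k (m + 1) with h | h
    · have := congrArg (Nat.cast : ℕ → R) (Nat.choose_succ_right_eq (m + 1) k)
      push_cast [Nat.cast_sub h] at this
      linear_combination this
    · simp [Nat.choose_eq_zero_of_lt h, Nat.choose_eq_zero_of_lt (show m + 1 < k + 1 by omega)]
  linear_combination ((m : R) + 2) ^ 2 * h1 + ((m : R) + 1) * h2 - ((m : R) + k + 3) * h3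

/-- The recurrence summed up to `k = K`: multiplication by `X - k (k + 1)` shifts `pairPoly`, so
that everything telescopes to one boundary term. -/
theorem dualPoly_partial_sum {m : ℕ} (hm : m + 1 < p) (K : ℕ) (hK : K ≤ m + 1) :
    ∑ k ∈ range (K + 1), (((m : ℤ_[p][X]) + 2) ^ 2 * (((m + 2).choose k : ℕ) : ℤ_[p][X])
        - (X + 2 * ((m : ℤ_[p][X]) + 1) ^ 2 + 2 * ((m : ℤ_[p][X]) + 1) + 1)
          * (((m + 1).choose k : ℕ) : ℤ_[p][X])
        + ((m : ℤ_[p][X]) + 1) ^ 2 * ((m.choose k : ℕ) : ℤ_[p][X])) * pairPoly p k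
      = -((((m + 1).choose K : ℕ) : ℤ_[p][X])
        * ((X - (K : ℤ_[p][X]) * ((K : ℤ_[p][X]) + 1)) * pairPoly p K)) := by
  induction K with
  | zero => simp [pairPoly]; ring
  | succ K ih =>
    rw [sum_range_succ, ih (by omega), ← pairPoly_succ (k := K) (by omega)]
    have h := choose_three_term (R := ℤ_[p][X]) m K
    push_cast
    linear_combination pairPoly p (K + 1) * h

/-- The three-term recurrence of the continuous dual Hahn polynomials `s_n`. -/
theorem nextDualPoly_succ {m : ℕ} (hm : m + 1 < p) :
    nextDualPoly p (m + 1) = (X + 2 * ((m : ℤ_[p][X]) + 1) ^ 2 + 2 * ((m : ℤ_[p][X]) + 1) + 1)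
      * dualPoly p (m + 1) - ((m : ℤ_[p][X]) + 1) ^ 2 * dualPoly p m := by
  have h := dualPoly_partial_sum hm (m + 1) le_rfl
  have h0 : dualPoly p m = ∑ k ∈ range (m + 1 + 1), (m.choose k : ℤ_[p][X]) * pairPoly p k := by
    rw [sum_range_succ _ (m + 1), dualPoly, Nat.choose_succ_self]
    simp
  simp only [add_mul, sub_mul, sum_add_distrib, sum_sub_distrib, mul_assoc, ← mul_sum,
    Nat.choose_self] at h
  rw [nextDualPoly, h0, dualPoly]
  simp only [add_mul, sub_mul, mul_assoc]
  push_cast at h ⊢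
  linear_combination h

/-- The confluent Christoffel–Darboux formula. -/
theorem sum_dualPoly_sq {N : ℕ} (hN : N < p) :
    ∑ n ∈ range (N + 1), dualPoly p n ^ 2
      = derivative (nextDualPoly p N) * dualPoly p N
        - nextDualPoly p N * derivative (dualPoly p N) := by
  induction N with
  | zero => simp [dualPoly, nextDualPoly, pairPoly]
  | succ N ih =>
    rw [sum_range_succ, ih (by omega), nextDualPoly_eq (by omega), nextDualPoly_succ hN]
    simp only [derivative_mul, derivative_add, derivative_sub, derivative_X, derivative_pow,
      derivative_natCast, derivative_one, derivative_ofNat]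
    ring

/-- The polynomial `∏_{i<p} (X - i (i + 1))`. -/
noncomputable def pronicPoly (p : ℕ) [Fact p.Prime] : ℤ_[p][X] :=
  ∏ i ∈ range p, (X - (i : ℤ_[p][X]) * ((i : ℤ_[p][X]) + 1))

/-- The last term of `p² s_p` is `pronicPoly p / (p - 1)!²`, its first term is `p²`, and the
binomial coefficients make all others divisible by `p ^ 3`. -/
theorem exists_nextDualPoly_pred_eq : ∃ W : ℤ_[p][X],
    (((p - 1).factorial : ℕ) : ℤ_[p][X]) ^ 2 * nextDualPoly p (p - 1)
      = pronicPoly p + (((p - 1).factorial : ℕ) : ℤ_[p][X]) ^ 2 * (p : ℤ_[p][X]) ^ 2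
        * (1 + (p : ℤ_[p][X]) * W) := by
  have hp := (Fact.out : p.Prime)
  obtain ⟨n, hn⟩ : ∃ n, p = n + 1 := ⟨p - 1, by have := hp.pos; omega⟩
  have hn' : p - 1 = n := by omega
  have hdiv : (p : ℤ_[p][X]) ∣
      ∑ k ∈ range n, ((n + 1).choose (k + 1) : ℤ_[p][X]) * pairPoly p (k + 1) := by
    refine dvd_sum fun k hk => Dvd.dvd.mul_right ?_ _
    have hk' := mem_range.mp hk
    rw [← hn]
    exact_mod_cast Nat.cast_dvd_cast (α := ℤ_[p][X])
      (hp.dvd_choose_self k.succ_ne_zero (by omega))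
  obtain ⟨W, hW⟩ := hdiv
  refine ⟨W, ?_⟩
  have hprod : pronicPoly p = ((n.factorial : ℕ) : ℤ_[p][X]) ^ 2
      * ((X - (n : ℤ_[p][X]) * ((n : ℤ_[p][X]) + 1)) * pairPoly p n) := by
    rw [pronicPoly, show range p = range (n + 1) by rw [← hn], prod_range_succ,
      ← factorial_sq_mul_pairPoly (by omega)]
    ring
  have hcast : (p : ℤ_[p][X]) = n + 1 := by
    rw [show ((p : ℕ) : ℤ_[p][X]) = ((n + 1 : ℕ) : ℤ_[p][X]) by rw [← hn]]; push_cast; ring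
  rw [hn', nextDualPoly, sum_range_succ', hW, hprod, hcast]
  simp [pairPoly]
  ring

/-- Modulo `p ^ 3`, the sum of squares only involves `s_{p-1}`, its derivative, and
`pronicPoly`. -/
theorem exists_sum_dualPoly_sq_eq : ∃ W : ℤ_[p][X],
    (((p - 1).factorial : ℕ) : ℤ_[p][X]) ^ 2 * ∑ n ∈ range p, dualPoly p n ^ 2
      = derivative (pronicPoly p) * dualPoly p (p - 1)
        - (pronicPoly p + (((p - 1).factorial : ℕ) : ℤ_[p][X]) ^ 2 * (p : ℤ_[p][X]) ^ 2)
          * derivative (dualPoly p (p - 1)) + (p : ℤ_[p][X]) ^ 3 * W := by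
  have hp := (Fact.out : p.Prime).pos
  obtain ⟨W, hW⟩ := exists_nextDualPoly_pred_eq (p := p)
  have hW' := congrArg derivative hW
  simp only [derivative_mul, derivative_add, derivative_pow, derivative_natCast,
    derivative_one] at hW'
  have hsum := sum_dualPoly_sq (p := p) (N := p - 1) (by omega)
  rw [show range (p - 1 + 1) = range p by congr 1; omega] at hsum
  refine ⟨(((p - 1).factorial : ℕ) : ℤ_[p][X]) ^ 2
    * (derivative W * dualPoly p (p - 1) - W * derivative (dualPoly p (p - 1))), ?_⟩
  rw [hsum]
  linear_combination dualPoly p (p - 1) * hW' - derivative (dualPoly p (p - 1)) * hW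

end ChristoffelDarboux

/-! ### The polynomial `∏ (X - i (i + 1))` and its cofactors -/

section PronicPolynomial

open Finset Polynomial

theorem ZMod.prod_X_sub_C (p : ℕ) [Fact p.Prime] :
    ∏ a : ZMod p, (X - C a) = (X ^ p - X : (ZMod p)[X]) := by
  have hp := (Fact.out : p.Prime).one_lt
  have hroots := FiniteField.roots_X_pow_card_sub_X (ZMod p)
  rw [ZMod.card] at hroots
  have h := prod_multiset_X_sub_C_of_monic_of_roots_card_eq (p := (X ^ p - X : (ZMod p)[X]))
    (monic_X_pow_sub (by rw [degree_X]; exact_mod_cast hp))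
    (by rw [hroots, FiniteField.X_pow_card_sub_X_natDegree_eq _ hp]; simp)
  rw [hroots] at h
  exact h

theorem prod_range_split {M : Type*} [CommMonoid M] {p r m : ℕ} (h : p = r + 1 + m) (g : ℕ → M) :
    ∏ i ∈ range p, g i = g r * ((∏ i ∈ range r, g i) * ∏ j ∈ range m, g (r + 1 + j)) := by
  rw [show range p = range (r + 1 + m) by rw [← h], prod_range_add, prod_range_succ]
  ac_rfl

variable {p : ℕ} [Fact p.Prime]

/-- If `B` is `∏_{a ≠ c} (X - a)` over `ZMod p`, then it is a polynomial in `(X - c) ^ (p - 1)`. -/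
theorem eq_of_X_sub_C_mul_eq {c : ZMod p} {B : (ZMod p)[X]} (h : (X - C c) * B = X ^ p - X) :
    B = (X - C c) ^ (p - 1) - 1 := by
  have hp := (Fact.out : p.Prime).pos
  apply mul_left_cancel₀ (X_sub_C_ne_zero c)
  have hpow : (X - C c) * (X - C c) ^ (p - 1) = X ^ p - C c := by
    rw [← pow_succ', Nat.sub_add_cancel hp, sub_pow_char, ← C_pow, ZMod.pow_card]
  rw [h, mul_sub, hpow]
  ring

/-- The product `∏ (X - i) (X + 1 + j)` over `i ≠ r` and `j ≠ m` in `{0, …, r + m}`. For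
`p = r + m + 1` it is what remains of `∏_{i<p} (X - i) (X + 1 + i)` after removing the two factors
that vanish modulo `p` at `X = r`. -/
noncomputable def cofactorPoly (p : ℕ) [Fact p.Prime] (r m : ℕ) : ℤ_[p][X] :=
  ((∏ i ∈ range r, (X - (i : ℤ_[p][X]))) * ∏ j ∈ range m, (X - ((r + 1 + j : ℕ) : ℤ_[p][X])))
    * ((∏ j ∈ range m, (X + 1 + (j : ℤ_[p][X])))
      * ∏ j ∈ range r, (X + 1 + ((m + 1 + j : ℕ) : ℤ_[p][X])))

theorem pronicPoly_comp_eq_prod : (pronicPoly p).comp (X * (X + 1))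
    = (∏ i ∈ range p, (X - (i : ℤ_[p][X]))) * ∏ i ∈ range p, (X + 1 + (i : ℤ_[p][X])) := by
  rw [pronicPoly, Polynomial.prod_comp, ← prod_mul_distrib]
  refine prod_congr rfl fun i _ => ?_
  simp only [sub_comp, X_comp, mul_comp, add_comp, natCast_comp, one_comp]
  ring

theorem pronicPoly_comp {r m : ℕ} (h : p = r + 1 + m) :
    (pronicPoly p).comp (X * (X + 1))
      = (X - (r : ℤ_[p][X])) * (X + 1 + (m : ℤ_[p][X])) * cofactorPoly p r m := by
  rw [pronicPoly_comp_eq_prod, prod_range_split h,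
    prod_range_split (r := m) (m := r) (by omega) (fun i => X + 1 + (i : ℤ_[p][X])), cofactorPoly]
  ring

/-- Modulo `p`, each half of `cofactorPoly p r m` is `∏_{a ≠ r} (X - a)`. -/
theorem map_cofactorPoly {r m : ℕ} (h : p = r + 1 + m) :
    (cofactorPoly p r m).map PadicInt.toZMod = ((X - C (r : ZMod p)) ^ (p - 1) - 1) ^ 2 := by
  have hm : (m : ZMod p) + 1 = -r := by
    have := congrArg (Nat.cast : ℕ → ZMod p) h
    rw [ZMod.natCast_self] at this
    push_cast at this
    linear_combination -this
  have h1 := ZMod.prod_range_natCast p (fun a => (X - C a : (ZMod p)[X]))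
  rw [ZMod.prod_X_sub_C, prod_range_split h] at h1
  have h2 : ∏ a : ZMod p, (X + 1 + C a) = (X ^ p - X : (ZMod p)[X]) := by
    rw [← ZMod.prod_X_sub_C, ← Equiv.prod_comp (Equiv.subLeft (-1 : ZMod p))]
    refine prod_congr rfl fun a _ => ?_
    simp only [Equiv.subLeft_apply, map_sub, map_neg, map_one]
    ring
  rw [← ZMod.prod_range_natCast p (fun a => (X + 1 + C a : (ZMod p)[X])),
    prod_range_split (r := m) (m := r) (by omega)] at h2
  have hX : (X + 1 + C (m : ZMod p) : (ZMod p)[X]) = X - C (r : ZMod p) := by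
    rw [sub_eq_add_neg, ← map_neg, ← hm, map_add, map_one]
    ring
  rw [hX] at h2
  rw [cofactorPoly, Polynomial.map_mul, sq]
  congr 1
  · rw [← eq_of_X_sub_C_mul_eq h1]
    simp [Polynomial.map_prod]
  · rw [← eq_of_X_sub_C_mul_eq h2]
    simp [Polynomial.map_prod]

theorem eval_derivative_dvd_iff (f : ℤ_[p][X]) (x : ℤ_[p]) :
    (p : ℤ_[p]) ∣ (derivative f).eval x
      ↔ (derivative (f.map PadicInt.toZMod)).eval (PadicInt.toZMod x) = 0 := by
  rw [← PadicInt.toZMod_eq_zero_iff, derivative_map, eval_map_apply]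

theorem dvd_eval_derivative_cofactorPoly (hp : 2 < p) {r m : ℕ} (h : p = r + 1 + m) (t : ℤ_[p]) :
    (p : ℤ_[p]) ∣ (derivative (cofactorPoly p r m)).eval ((r : ℤ_[p]) + (p : ℤ_[p]) * t) := by
  rw [eval_derivative_dvd_iff, map_cofactorPoly h]
  have hx : PadicInt.toZMod ((r : ℤ_[p]) + (p : ℤ_[p]) * t) = r := by simp
  have h0 : (0 : ZMod p) ^ (p - 1 - 1) = 0 := zero_pow (by omega)
  simp [hx, derivative_pow, h0]

theorem factorial_mul_prod_range {R : Type*} [CommRing R] (a b : ℕ) :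
    (a.factorial : R) * ∏ j ∈ range b, ((a : R) + 1 + j) = ((a + b).factorial : ℕ) := by
  induction b with
  | zero => simp
  | succ b ih =>
    rw [prod_range_succ, ← mul_assoc, ih, ← add_assoc, Nat.factorial_succ]
    push_cast
    ring

/-- The same products of `p - i` and `p + i` appear in the value of `s_{p-1}` at `r`, and cancel
there. -/
theorem eval_cofactorPoly (hp : p ≠ 2) {r m : ℕ} (h : p = r + 1 + m) :
    (cofactorPoly p r m).eval (r : ℤ_[p]) * ∏ i ∈ range r, ((p : ℤ_[p]) - (i + 1))
      = (-1) ^ r * (((p - 1).factorial : ℕ) : ℤ_[p]) ^ 2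
        * ∏ i ∈ range r, ((p : ℤ_[p]) + (i + 1)) := by
  have hcast : (p : ℤ_[p]) = r + 1 + m := by
    rw [show ((p : ℕ) : ℤ_[p]) = ((r + 1 + m : ℕ) : ℤ_[p]) by rw [← h]]; push_cast; ring
  have hrev : ∀ n : ℕ, ∏ i ∈ range r, ((r : ℤ_[p]) + n - i)
      = ∏ j ∈ range r, ((n : ℤ_[p]) + 1 + j) := by
    intro n
    rw [← prod_range_reflect]
    refine prod_congr rfl fun j hj => ?_
    have hj' := mem_range.mp hj
    rw [Nat.cast_sub (by omega), Nat.cast_sub (by omega)]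
    push_cast
    ring
  have h1 : ∏ i ∈ range r, ((r : ℤ_[p]) - i) = r.factorial := by
    have e := hrev 0
    have := factorial_mul_prod_range (R := ℤ_[p]) 0 r
    simp only [Nat.cast_zero, add_zero, zero_add, Nat.factorial_zero, Nat.cast_one,
      one_mul] at e this
    rw [e, this]
  have h2 : ∏ j ∈ range m, ((r : ℤ_[p]) - ((r + 1 + j : ℕ) : ℤ_[p])) = (-1) ^ m * m.factorial := by
    have := factorial_mul_prod_range (R := ℤ_[p]) 0 m
    simp only [Nat.cast_zero, zero_add, Nat.factorial_zero, Nat.cast_one, one_mul] at this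
    rw [← this]
    calc _ = ∏ j ∈ range m, (-1) * ((1 : ℤ_[p]) + j) :=
          prod_congr rfl fun j _ => by push_cast; ring
      _ = _ := by rw [prod_mul_distrib, prod_const, card_range]
  have h3 := factorial_mul_prod_range (R := ℤ_[p]) r m
  have h4 := factorial_mul_prod_range (R := ℤ_[p]) m r
  have h5 : ∏ i ∈ range r, ((p : ℤ_[p]) - (i + 1)) = ∏ j ∈ range r, ((m : ℤ_[p]) + 1 + j) := by
    rw [← hrev m]
    exact prod_congr rfl fun i _ => by rw [hcast]; ring
  have h6 : ∏ j ∈ range r, ((r : ℤ_[p]) + 1 + ((m + 1 + j : ℕ) : ℤ_[p]))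
      = ∏ i ∈ range r, ((p : ℤ_[p]) + (i + 1)) :=
    prod_congr rfl fun i _ => by rw [hcast]; push_cast; ring
  have hsign : ((-1) ^ m : ℤ_[p]) = (-1) ^ r := by
    have hodd := (Fact.out : p.Prime).odd_of_ne_two hp
    have hparity : Even (r + m) := by
      rw [h] at hodd
      have : r + 1 + m = r + m + 1 := by omega
      rw [this, Nat.odd_add_one, Nat.not_odd_iff_even] at hodd
      exact hodd
    rcases Nat.even_or_odd r with hr | hr
    · rw [hr.neg_one_pow, ((Nat.even_add.mp hparity).mp hr).neg_one_pow]
    · have : Odd m := by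
        rw [← Nat.not_even_iff_odd] at hr ⊢
        exact fun hm => hr ((Nat.even_add.mp hparity).mpr hm)
      rw [hr.neg_one_pow, this.neg_one_pow]
  have hp1 : p - 1 = r + m := by omega
  rw [cofactorPoly, hp1, h5]
  simp only [eval_mul, eval_prod, eval_sub, eval_add, eval_X, eval_natCast, eval_one]
  rw [h1, h2, h6, hsign, sq]
  nth_rewrite 2 [← h3]
  rw [add_comm r m, ← h4]
  ring

/-- For `p = 2 h + 1`, the polynomial `pronicPoly p` with its factor at `i = h` removed. -/
noncomputable def centralPoly (p : ℕ) [Fact p.Prime] (h : ℕ) : ℤ_[p][X] :=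
  (∏ i ∈ range h, (X - (i : ℤ_[p][X]) * ((i : ℤ_[p][X]) + 1)))
    * ∏ j ∈ range h, (X - ((h + 1 + j : ℕ) : ℤ_[p][X]) * (((h + 1 + j : ℕ) : ℤ_[p][X]) + 1))

theorem pronicPoly_eq_mul_centralPoly {h : ℕ} (hh : p = h + 1 + h) :
    pronicPoly p = (X - (h : ℤ_[p][X]) * ((h : ℤ_[p][X]) + 1)) * centralPoly p h := by
  rw [pronicPoly, prod_range_split hh, centralPoly]

theorem centralPoly_comp (h : ℕ) :
    (centralPoly p h).comp (X * (X + 1)) = cofactorPoly p h h := by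
  have hf : ∀ i : ℕ, (X - (i : ℤ_[p][X]) * ((i : ℤ_[p][X]) + 1)).comp (X * (X + 1))
      = (X - (i : ℤ_[p][X])) * (X + 1 + (i : ℤ_[p][X])) := by
    intro i
    simp only [sub_comp, X_comp, mul_comp, add_comp, natCast_comp, one_comp]
    ring
  rw [centralPoly, mul_comp, Polynomial.prod_comp, Polynomial.prod_comp]
  simp only [hf, prod_mul_distrib]
  rw [cofactorPoly]
  ring

/-- Over `ZMod p`, with `c = (p - 1) / 2`, the substitution `X (X + 1) = (X - c)² + c (c + 1)`
turns `centralPoly` into `((X - c)^{p-1} - 1)²`. It is thus a polynomial in `(X - c (c +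
1))^{(p-1)/2}`, and its derivative at `c (c + 1)` vanishes when `p > 3`. -/
theorem dvd_eval_derivative_centralPoly (hp : 3 < p) {h : ℕ} (hh : p = h + 1 + h)
    (t : ℤ_[p]) : (p : ℤ_[p]) ∣ (derivative (centralPoly p h)).eval
      (((h : ℤ_[p]) + (p : ℤ_[p]) * t) * ((h : ℤ_[p]) + (p : ℤ_[p]) * t + 1)) := by
  rw [eval_derivative_dvd_iff]
  set G := (centralPoly p h).map PadicInt.toZMod
  have hc : 2 * (h : ZMod p) + 1 = 0 := by
    have := congrArg (Nat.cast : ℕ → ZMod p) hh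
    rw [ZMod.natCast_self] at this
    push_cast at this
    linear_combination -this
  have hcomp : G.comp (X * (X + 1)) = ((X - C (h : ZMod p)) ^ (p - 1) - 1) ^ 2 := by
    rw [← map_cofactorPoly hh, ← centralPoly_comp, Polynomial.map_comp]
    simp [G]
  have hd := congrArg derivative hcomp
  rw [derivative_comp] at hd
  have hX : derivative (X * (X + 1) : (ZMod p)[X]) = (X - C (h : ZMod p)) * 2 := by
    have : (1 : (ZMod p)[X]) = -(2 * C (h : ZMod p)) := by
      have := congrArg C hc
      rw [map_add, map_mul, map_one, map_zero, map_ofNat] at this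
      linear_combination this
    rw [derivative_mul, derivative_add, derivative_X, derivative_one]
    linear_combination this
  have hsq : derivative (((X - C (h : ZMod p)) ^ (p - 1) - 1) ^ 2)
      = 2 * ((X - C (h : ZMod p)) ^ (p - 1) - 1)
        * (C ((p - 1 : ℕ) : ZMod p) * (X - C (h : ZMod p)) ^ (p - 1 - 1)) := by
    rw [derivative_sq, derivative_sub, derivative_X_sub_C_pow, derivative_one, sub_zero, map_ofNat]
  rw [hX, hsq, show p - 1 - 1 = (p - 4) + 1 + 1 by omega, pow_succ] at hd
  have hd' : 2 * (derivative G).comp (X * (X + 1)) = 2 * ((X - C (h : ZMod p)) ^ (p - 1) - 1)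
      * (C ((p - 1 : ℕ) : ZMod p) * (X - C (h : ZMod p)) ^ (p - 4 + 1)) := by
    apply mul_left_cancel₀ (X_sub_C_ne_zero (h : ZMod p))
    linear_combination hd
  have he := congrArg (eval (h : ZMod p)) hd'
  have h2 : (2 : ZMod p) ≠ 0 := by
    intro h0
    have := (ZMod.natCast_eq_zero_iff 2 p).mp (by exact_mod_cast h0)
    exact absurd (Nat.le_of_dvd two_pos this) (by omega)
  simp only [eval_mul, eval_pow, eval_sub, eval_X, eval_C, sub_self, eval_comp, eval_add, eval_one,
    eval_ofNat, pow_succ (0 : ZMod p) (p - 4), mul_zero, mul_eq_zero, h2, false_or] at he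
  simpa using he

end PronicPolynomial

/-! ### The congruence when `2 x + 1` is a unit -/

section Congruence

open Finset Polynomial

variable {p : ℕ} [Fact p.Prime]

theorem isUnit_prod_add {r : ℕ} (hr : r < p) :
    IsUnit (∏ i ∈ range r, ((p : ZMod (p ^ 3)) + (i + 1))) := by
  rw [IsUnit.prod_iff]
  intro i hi
  have hi' := mem_range.mp hi
  have hn : IsNilpotent (p : ZMod (p ^ 3)) := ⟨3, natCast_pow_three_eq_zero p⟩
  exact hn.isUnit_add_right_of_commute
    (IsUnit.of_mul_eq_one _ (toZModPow_succ_mul_succInv (by omega))) (Commute.all _ _)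

theorem isUnit_prod_sub {r : ℕ} (hr : r < p) :
    IsUnit (∏ i ∈ range r, ((p : ZMod (p ^ 3)) - (i + 1))) := by
  rw [IsUnit.prod_iff]
  intro i hi
  have hi' := mem_range.mp hi
  have hn : IsNilpotent (p : ZMod (p ^ 3)) := ⟨3, natCast_pow_three_eq_zero p⟩
  rw [sub_eq_add_neg]
  exact hn.isUnit_add_right_of_commute
    (IsUnit.of_mul_eq_one _ (toZModPow_succ_mul_succInv (p := p) (k := i) (by omega))).neg
    (Commute.all _ _)

theorem isUnit_factorial_pred :
    IsUnit ((((p - 1).factorial : ℕ) : ZMod (p ^ 3)) ^ 2) := by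
  refine IsUnit.pow 2 ?_
  rw [ZMod.isUnit_iff_coprime]
  have hp := (Fact.out : p.Prime)
  refine Nat.Coprime.pow_right 3 ((Nat.coprime_comm.mp ?_))
  rw [hp.coprime_iff_not_dvd, hp.dvd_factorial]
  have := hp.pos
  omega

theorem sq_mul_prod_sub {R : Type*} [CommRing R] {π : R} (h3 : π ^ 3 = 0) (r : ℕ) :
    π ^ 2 * ∏ i ∈ range r, (π - (i + 1)) = (-1) ^ r * (π ^ 2 * ∏ i ∈ range r, (π + (i + 1))) := by
  induction r with
  | zero => simp
  | succ r ih =>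
    rw [prod_range_succ, prod_range_succ, pow_succ]
    linear_combination (π - (r + 1)) * ih
      + 2 * (-1) ^ r * (∏ i ∈ range r, (π + ((i : R) + 1))) * h3

/-- The value of `s_{p-1}` at `r + p t` modulo `p ^ 2`. -/
theorem natCast_mul_toZModPow_dualSeq (hp : 3 < p) (t : ℤ_[p]) {r : ℕ} (hr : r < p) :
    (p : ZMod (p ^ 3)) * PadicInt.toZModPow 3 (dualSeq (p - 1) ((r : ℤ_[p]) + (p : ℤ_[p]) * t))
        * ∏ i ∈ range r, ((p : ZMod (p ^ 3)) + (i + 1))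
      = p * ∏ i ∈ range r, ((p : ZMod (p ^ 3)) - (i + 1)) := by
  have h := toZModPow_dualSeq_natCast_add hp t hr
  have h3 := natCast_pow_three_eq_zero p
  rw [mul_assoc, h, correction]
  generalize (∏ i ∈ range r, ((p : ZMod (p ^ 3)) - (i + 1))) = N
  generalize (∑ i ∈ range r, (-1) ^ (i + 1) * PadicInt.toZModPow 3 (succInv p i) ^ 2) = A
  generalize (∑ i ∈ range r, PadicInt.toZModPow 3 (succInv p i) ^ 2) = B
  generalize PadicInt.toZModPow 3 t = τ
  linear_combination N * (2 * A * (1 + τ ^ 2) + 2 * τ * (A + B)) * h3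

/-- The congruence `exists_sum_dualPoly_sq_eq` evaluated at `x (x + 1)`. -/
theorem factorial_mul_sum_sq (x : ℤ_[p]) :
    ∃ w : ℤ_[p], (((p - 1).factorial : ℕ) : ℤ_[p]) ^ 2 * ∑ n ∈ range p, dualSeq n x ^ 2
      = (derivative (pronicPoly p)).eval (x * (x + 1)) * dualSeq (p - 1) x
        - ((pronicPoly p).eval (x * (x + 1))
            + (((p - 1).factorial : ℕ) : ℤ_[p]) ^ 2 * (p : ℤ_[p]) ^ 2)
          * (derivative (dualPoly p (p - 1))).eval (x * (x + 1)) + (p : ℤ_[p]) ^ 3 * w := by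
  have hp := (Fact.out : p.Prime).pos
  obtain ⟨W, hW⟩ := exists_sum_dualPoly_sq_eq (p := p)
  refine ⟨W.eval (x * (x + 1)), ?_⟩
  have h := congrArg (eval (x * (x + 1))) hW
  simp only [eval_mul, eval_pow, eval_add, eval_sub, eval_natCast, eval_finsetSum] at h
  rw [eval_dualPoly x (by omega)] at h
  rw [← h]
  congr 1
  exact sum_congr rfl fun n hn => by rw [eval_dualPoly x (mem_range.mp hn)]

theorem exists_eval_add_eq (f : ℤ_[p][X]) (x y : ℤ_[p]) :
    ∃ k, f.eval (x + y) = f.eval x + (derivative f).eval x * y + k * y ^ 2 :=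
  ⟨_, (binomExpansion f x y).2⟩

theorem isUnit_two_mul_add_one {r m : ℕ} (h : p = r + 1 + m) (hrm : r ≠ m) (t : ℤ_[p]) :
    IsUnit (2 * ((r : ℤ_[p]) + (p : ℤ_[p]) * t) + 1) := by
  rw [PadicInt.isUnit_iff_not_dvd, ← PadicInt.toZMod_eq_zero_iff]
  intro h0
  have h1 : ((2 * r + 1 : ℕ) : ZMod p) = 0 := by
    push_cast
    rwa [map_add, map_mul, map_add, map_mul, map_natCast, map_natCast, ZMod.natCast_self, zero_mul,
      add_zero, map_ofNat, map_one] at h0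
  obtain ⟨k, hk⟩ := (ZMod.natCast_eq_zero_iff _ _).mp h1
  have hk1 : k < 2 := by
    by_contra hcon
    have := Nat.mul_le_mul_left p (not_lt.mp hcon)
    omega
  interval_cases k <;> omega

/-- Modulo `p ^ 2` the values of `s_{p-1}` at `x` and `x + p` agree, while `x (x + 1)` changes by
`p` times a unit. -/
theorem dvd_eval_derivative_dualPoly (hp : 3 < p) {r m : ℕ} (h : p = r + 1 + m) (hrm : r ≠ m)
    (t : ℤ_[p]) : (p : ℤ_[p]) ∣ (derivative (dualPoly p (p - 1))).eval
      (((r : ℤ_[p]) + (p : ℤ_[p]) * t) * ((r : ℤ_[p]) + (p : ℤ_[p]) * t + 1)) := by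
  have h1 := natCast_mul_toZModPow_dualSeq hp t (r := r) (by omega)
  have h2 := natCast_mul_toZModPow_dualSeq hp (t + 1) (r := r) (by omega)
  have h4 := (isUnit_prod_add (p := p) (r := r) (by omega)).mul_right_cancel (h1.trans h2.symm)
  rw [← map_natCast (PadicInt.toZModPow (p := p) 3), ← map_mul, ← map_mul,
    PadicInt.toZModPow_eq_iff] at h4
  obtain ⟨w, hw⟩ := h4
  have hu := isUnit_two_mul_add_one h hrm t
  set x : ℤ_[p] := (r : ℤ_[p]) + (p : ℤ_[p]) * t with hx
  rw [show (r : ℤ_[p]) + (p : ℤ_[p]) * (t + 1) = x + p by rw [hx]; ring,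
    ← eval_dualPoly x (by omega), ← eval_dualPoly (x + (p : ℤ_[p])) (by omega)] at hw
  obtain ⟨k, hk⟩ := exists_eval_add_eq (dualPoly p (p - 1)) (x * (x + 1))
    ((p : ℤ_[p]) * (2 * x + 1 + p))
  rw [show x * (x + 1) + (p : ℤ_[p]) * (2 * x + 1 + p) = (x + p) * (x + p + 1) by ring] at hk
  rw [hk] at hw
  have hp0 : (p : ℤ_[p]) ^ 2 ≠ 0 := pow_ne_zero 2 (by exact_mod_cast (Fact.out : p.Prime).ne_zero)
  rw [← hu.dvd_mul_left]
  refine ⟨-w - k * (2 * x + 1 + p) ^ 2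
    - (derivative (dualPoly p (p - 1))).eval (x * (x + 1)), ?_⟩
  apply mul_left_cancel₀ hp0
  linear_combination -hw

/-- The congruence when `2 x + 1` is a unit. -/
theorem sum_sq_of_ne (hp : 3 < p) {r m : ℕ} (h : p = r + 1 + m) (hrm : r ≠ m) (t : ℤ_[p]) :
    (p : ℤ_[p]) ^ 3 ∣ (2 * ((r : ℤ_[p]) + (p : ℤ_[p]) * t) + 1)
        * ∑ n ∈ range p, dualSeq n ((r : ℤ_[p]) + (p : ℤ_[p]) * t) ^ 2
      - (-1) ^ r * ((p : ℤ_[p]) + 2 * (p * t)) := by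
  have hr : r < p := by omega
  have hpcast : (p : ℤ_[p]) = r + 1 + m := by
    rw [show ((p : ℕ) : ℤ_[p]) = ((r + 1 + m : ℕ) : ℤ_[p]) by rw [← h]]; push_cast; ring
  have hS := natCast_mul_toZModPow_dualSeq hp t hr
  obtain ⟨d, hd⟩ := dvd_eval_derivative_dualPoly hp h hrm t
  obtain ⟨o, ho⟩ := dvd_eval_derivative_cofactorPoly (by omega) h t
  have hO := eval_cofactorPoly (p := p) (by omega) h
  set x : ℤ_[p] := (r : ℤ_[p]) + (p : ℤ_[p]) * t with hx
  obtain ⟨w, hw⟩ := factorial_mul_sum_sq x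
  obtain ⟨k, hk⟩ := exists_eval_add_eq (cofactorPoly p r m) x (-(p * t))
  rw [show x + -((p : ℤ_[p]) * t) = r by rw [hx]; ring, ho] at hk
  have hQ := pronicPoly_comp h
  have hQ0 := congrArg (eval x) hQ
  have hQ1 := congrArg (fun f => eval x (derivative f)) hQ
  simp only [derivative_comp, derivative_mul, derivative_add, derivative_sub, derivative_X,
    derivative_one, derivative_natCast, eval_comp, eval_mul, eval_add, eval_sub, eval_X, eval_one,
    eval_natCast, eval_zero] at hQ0 hQ1
  rw [ho] at hQ1
  rw [show x - (r : ℤ_[p]) = p * t by rw [hx]; ring,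
    show x + 1 + (m : ℤ_[p]) = p * (t + 1) by rw [hx]; linear_combination -hpcast] at hQ0 hQ1
  rw [hQ0, hd] at hw
  rw [← PadicInt.toZModPow_eq_iff]
  set φ := PadicInt.toZModPow (p := p) 3
  replace hw := congrArg φ hw
  replace hQ1 := congrArg φ hQ1
  replace hk := congrArg φ hk
  replace hO := congrArg φ hO
  simp only [map_mul, map_add, map_sub, map_pow, map_neg, map_one, map_ofNat, map_natCast,
    map_prod, map_zero] at hw hQ1 hk hO ⊢
  have h3 := natCast_pow_three_eq_zero p
  apply (isUnit_factorial_pred (p := p)).mul_left_cancel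
  apply (isUnit_prod_add hr).mul_left_cancel
  apply (isUnit_prod_sub hr).mul_left_cancel
  generalize φ (∑ n ∈ range p, dualSeq n x ^ 2) = F at *
  generalize ((((p - 1).factorial : ℕ) : ZMod (p ^ 3)) ^ 2) = c at *
  generalize (∏ i ∈ range r, ((p : ZMod (p ^ 3)) + (i + 1))) = D at *
  generalize (∏ i ∈ range r, ((p : ZMod (p ^ 3)) - (i + 1))) = N at *
  generalize φ (eval (x * (x + 1)) (derivative (pronicPoly p))) = P' at *
  generalize φ (eval x (cofactorPoly p r m)) = Ox at *
  generalize φ (eval (r : ℤ_[p]) (cofactorPoly p r m)) = Or at *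
  generalize φ (dualSeq (p - 1) x) = S at *
  generalize φ x = ξ at *
  generalize φ t = τ at *
  generalize φ d = δ at *
  generalize φ o = ω at *
  generalize φ w = w at *
  generalize φ k = κ at *
  generalize (p : ZMod (p ^ 3)) = π at *
  generalize ((-1 : ZMod (p ^ 3)) ^ r) = s at *
  -- `pronicPoly` is divisible by `p ^ 2` and the derivative of `s_{p-1}` by `p`.
  have hF : c * F = P' * S := by
    rw [hw]
    linear_combination (-(τ * (τ + 1) * Ox * δ) - c * δ + w) * h3
  -- The chain rule for `X (X + 1)` turns the derivative in `x (x + 1)` into one in `x`.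
  have hP' : P' * (2 * ξ + 1) = π * (2 * τ + 1) * Or := by
    linear_combination hQ1 - π * (2 * τ + 1) * hk
      + (τ * (τ + 1) * ω + (2 * τ + 1) * (τ * ω - κ * τ ^ 2)) * h3
  linear_combination N * D * (2 * ξ + 1) * hF + N * D * S * hP' + (2 * τ + 1) * π * D * S * hO
    + (2 * τ + 1) * s * c * D * hS

end Congruence

/-! ### The congruence when `p` divides `2 x + 1` -/

section CentralResidue

open Finset Polynomial

variable {p : ℕ} [Fact p.Prime]

/-- For `p = 2 h + 1`, the values of `s_{p-1}` and of its derivative at `h (h + 1)` modulo `p ^ 3`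
and modulo `p`, in terms of one common quantity `a`. -/
theorem exists_central_values (hp : 3 < p) {h : ℕ} (hh : p = h + 1 + h) :
    ∃ a : ZMod (p ^ 3),
      PadicInt.toZModPow 3 (dualSeq (p - 1) (h : ℤ_[p]))
          * ∏ i ∈ range h, ((p : ZMod (p ^ 3)) + (i + 1))
        = (∏ i ∈ range h, ((p : ZMod (p ^ 3)) - (i + 1))) * (1 + a * (p : ZMod (p ^ 3)) ^ 2)
      ∧ (p : ZMod (p ^ 3)) ^ 2 * PadicInt.toZModPow 3
            ((derivative (dualPoly p (p - 1))).eval ((h : ℤ_[p]) * ((h : ℤ_[p]) + 1)))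
          * ∏ i ∈ range h, ((p : ZMod (p ^ 3)) + (i + 1))
        = (p : ZMod (p ^ 3)) ^ 2 * a * ∏ i ∈ range h, ((p : ZMod (p ^ 3)) - (i + 1)) := by
  have hlt : h < p := by omega
  have hpcast : (p : ℤ_[p]) = h + 1 + h := by
    rw [show ((p : ℕ) : ℤ_[p]) = ((h + 1 + h : ℕ) : ℤ_[p]) by rw [← hh]]; push_cast; ring
  have e0 := toZModPow_dualSeq_natCast_add hp 0 hlt
  have e1 := toZModPow_dualSeq_natCast_add hp 1 hlt
  have e2 := toZModPow_dualSeq_natCast_add hp (-1) hlt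
  -- The points `h` and `h - p` are exchanged by `x ↦ -1 - x`.
  rw [show (h : ℤ_[p]) + (p : ℤ_[p]) * (-1) = -1 - h by linear_combination -hpcast,
    dualSeq_neg_one_sub] at e2
  rw [mul_zero, add_zero] at e0
  rw [mul_one] at e1
  -- `x (x + 1)` at `x = h + p` exceeds its value at `h` by `2 p²`.
  obtain ⟨k, hk⟩ := exists_eval_add_eq (dualPoly p (p - 1)) ((h : ℤ_[p]) * ((h : ℤ_[p]) + 1))
    (2 * (p : ℤ_[p]) ^ 2)
  rw [show (h : ℤ_[p]) * ((h : ℤ_[p]) + 1) + 2 * (p : ℤ_[p]) ^ 2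
      = ((h : ℤ_[p]) + (p : ℤ_[p])) * ((h : ℤ_[p]) + (p : ℤ_[p]) + 1) by
        linear_combination (p : ℤ_[p]) * hpcast,
    eval_dualPoly _ (by omega), eval_dualPoly _ (by omega)] at hk
  have h3 := natCast_pow_three_eq_zero p
  have h2 := isUnit_two_zmod hp
  set φ := PadicInt.toZModPow (p := p) 3
  replace hk := congrArg φ hk
  simp only [map_mul, map_add, map_pow, map_ofNat, map_natCast] at hk
  refine ⟨2 * ∑ i ∈ range h, (-1) ^ (i + 1) * φ (succInv p i) ^ 2, ?_, ?_⟩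
  · rw [e0, correction, map_zero]
    ring
  · rw [correction, map_zero] at e0
    rw [correction, map_one] at e1
    rw [correction, map_neg, map_one] at e2
    generalize (∏ i ∈ range h, ((p : ZMod (p ^ 3)) + (i + 1))) = D at *
    generalize (∏ i ∈ range h, ((p : ZMod (p ^ 3)) - (i + 1))) = N at *
    generalize (∑ i ∈ range h, (-1) ^ (i + 1) * φ (succInv p i) ^ 2) = A at *
    generalize (∑ i ∈ range h, φ (succInv p i) ^ 2) = B at *
    generalize φ (dualSeq (p - 1) (h : ℤ_[p])) = S at *
    generalize φ (dualSeq (p - 1) ((h : ℤ_[p]) + (p : ℤ_[p]))) = S₁ at *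
    generalize φ (eval ((h : ℤ_[p]) * ((h : ℤ_[p]) + 1)) (derivative (dualPoly p (p - 1))))
      = S' at *
    generalize φ k = κ at *
    generalize (p : ZMod (p ^ 3)) = π at *
    -- Equality of the values at `h` and `h - p` forces `p ∣ B`.
    have hB : N * (2 * π ^ 2 * B) = 0 := by linear_combination e2 - e0
    apply h2.mul_left_cancel
    linear_combination -D * hk + e1 - e0 + hB - 4 * κ * D * π * h3

/-- The congruence when `p ∣ 2 x + 1`. -/
theorem sum_sq_of_central (hp : 3 < p) {h : ℕ} (hh : p = h + 1 + h) (t : ℤ_[p]) :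
    (p : ℤ_[p]) ^ 3 ∣ ∑ n ∈ range p, dualSeq n ((h : ℤ_[p]) + (p : ℤ_[p]) * t) ^ 2
      - (-1) ^ h := by
  have hlt : h < p := by omega
  have hpcast : (p : ℤ_[p]) = h + 1 + h := by
    rw [show ((p : ℕ) : ℤ_[p]) = ((h + 1 + h : ℕ) : ℤ_[p]) by rw [← hh]]; push_cast; ring
  obtain ⟨a, hS, hS'⟩ := exists_central_values hp hh
  have hO := eval_cofactorPoly (p := p) (by omega) hh
  rw [← centralPoly_comp, eval_comp] at hO
  simp only [eval_mul, eval_add, eval_X, eval_one] at hO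
  obtain ⟨g, hg⟩ := dvd_eval_derivative_centralPoly hp hh t
  set x : ℤ_[p] := (h : ℤ_[p]) + (p : ℤ_[p]) * t with hx
  -- Near the centre `x (x + 1)` varies with `p ^ 2`, not only with `p`.
  have hε : (h : ℤ_[p]) * ((h : ℤ_[p]) + 1) = x * (x + 1) + -((p : ℤ_[p]) ^ 2 * (t * (t + 1))) := by
    rw [hx]; linear_combination (p : ℤ_[p]) * t * hpcast
  obtain ⟨w, hw⟩ := factorial_mul_sum_sq x
  obtain ⟨k, hk⟩ := exists_eval_add_eq (centralPoly p h) (x * (x + 1))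
    (-((p : ℤ_[p]) ^ 2 * (t * (t + 1))))
  obtain ⟨l, hl⟩ := exists_eval_add_eq (dualPoly p (p - 1)) (x * (x + 1))
    (-((p : ℤ_[p]) ^ 2 * (t * (t + 1))))
  obtain ⟨d, hd⟩ := (derivative (dualPoly p (p - 1))).sub_dvd_eval_sub (x * (x + 1))
    ((h : ℤ_[p]) * ((h : ℤ_[p]) + 1))
  have hP := pronicPoly_eq_mul_centralPoly hh
  have hP0 := congrArg (eval (x * (x + 1))) hP
  have hP1 := congrArg (fun f => eval (x * (x + 1)) (derivative f)) hP
  simp only [derivative_mul, derivative_add, derivative_sub, derivative_X,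
    derivative_one, derivative_natCast, eval_mul, eval_add, eval_sub, eval_X, eval_one,
    eval_natCast, eval_zero] at hP0 hP1
  rw [← hε] at hk hl
  rw [hg] at hk hP1
  rw [eval_dualPoly _ (by omega), eval_dualPoly _ (by omega)] at hl
  rw [show x * (x + 1) - (h : ℤ_[p]) * ((h : ℤ_[p]) + 1) = (p : ℤ_[p]) ^ 2 * (t * (t + 1)) by
    rw [hε]; ring] at hP0 hP1 hd
  rw [← PadicInt.toZModPow_eq_iff]
  have h3 := natCast_pow_three_eq_zero p
  have hsign := sq_mul_prod_sub h3 h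
  set φ := PadicInt.toZModPow (p := p) 3
  replace hw := congrArg φ hw
  replace hk := congrArg φ hk
  replace hl := congrArg φ hl
  replace hd := congrArg φ hd
  replace hP0 := congrArg φ hP0
  replace hP1 := congrArg φ hP1
  replace hO := congrArg φ hO
  simp only [map_mul, map_add, map_sub, map_pow, map_neg, map_one, map_natCast,
    map_prod, map_zero] at hw hk hl hd hP0 hP1 hO ⊢
  apply (isUnit_factorial_pred (p := p)).mul_left_cancel
  apply (isUnit_prod_add hlt).mul_left_cancel
  apply (isUnit_prod_sub hlt).mul_left_cancel
  generalize φ (∑ n ∈ range p, dualSeq n x ^ 2) = F at *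
  generalize ((((p - 1).factorial : ℕ) : ZMod (p ^ 3)) ^ 2) = c at *
  generalize (∏ i ∈ range h, ((p : ZMod (p ^ 3)) + (i + 1))) = D at *
  generalize (∏ i ∈ range h, ((p : ZMod (p ^ 3)) - (i + 1))) = N at *
  generalize φ (eval (x * (x + 1)) (derivative (pronicPoly p))) = P' at *
  generalize φ (eval (x * (x + 1)) (pronicPoly p)) = P at *
  generalize φ (eval (x * (x + 1)) (centralPoly p h)) = G at *
  generalize φ (eval ((h : ℤ_[p]) * ((h : ℤ_[p]) + 1)) (centralPoly p h)) = G₀ at *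
  generalize φ (dualSeq (p - 1) x) = S at *
  generalize φ (dualSeq (p - 1) (h : ℤ_[p])) = S₀ at *
  generalize φ (eval (x * (x + 1)) (derivative (dualPoly p (p - 1)))) = S' at *
  generalize φ (eval ((h : ℤ_[p]) * ((h : ℤ_[p]) + 1)) (derivative (dualPoly p (p - 1)))) = S₀' at *
  generalize φ t = τ at *
  generalize φ d = δ at *
  generalize φ g = γ at *
  generalize φ w = w at *
  generalize φ k = κ at *
  generalize φ l = l at *
  generalize (p : ZMod (p ^ 3)) = π at *
  generalize ((-1 : ZMod (p ^ 3)) ^ h) = s at *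
  have hG : G = G₀ := by
    linear_combination -hk + (γ * (τ * (τ + 1)) - κ * π * (τ * (τ + 1)) ^ 2) * h3
  have hP' : P' = G₀ := by
    linear_combination hP1 + hG + γ * (τ * (τ + 1)) * h3
  have hSS : S = S₀ + π ^ 2 * (τ * (τ + 1)) * S' := by
    linear_combination -hl - l * π * (τ * (τ + 1)) ^ 2 * h3
  have hF : c * F = G₀ * S₀ - c * π ^ 2 * S₀' := by
    rw [hw, hP', hP0, hG, hSS]
    linear_combination w * h3 - c * π ^ 2 * hd - c * π * (τ * (τ + 1)) * δ * h3
  linear_combination N * D * hF + S₀ * D * hO + s * c * D * hS - c * N * hS' - c * a * N * hsign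

end CentralResidue

theorem theorem1p1 (p : ℕ) [Fact p.Prime] (hp : 3 < p) (x : ℤ_[p])
    (hx : (x : ℚ_[p]) ≠ -1 / 2) :
    PadicCongr 3
      ((∑ n ∈ Finset.range p, dualSeq n x ^ 2 : ℤ_[p]) : ℚ_[p])
      ((-1) ^ leastResidue x *
        (((p : ℚ_[p]) + 2 * ((x : ℚ_[p]) - (leastResidue x : ℚ_[p]))) /
          (2 * (x : ℚ_[p]) + 1))) := by
  have hr : leastResidue x < p := PadicInt.zmodRepr_lt_p x
  obtain ⟨t, ht⟩ : (p : ℤ_[p]) ∣ x - (leastResidue x : ℤ_[p]) := by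
    rw [← Ideal.mem_span_singleton, ← PadicInt.maximalIdeal_eq_span_p]
    exact PadicInt.sub_zmodRepr_mem x
  have hx' : x = (leastResidue x : ℤ_[p]) + (p : ℤ_[p]) * t := by rw [← ht]; ring
  have hne : (2 * (x : ℚ_[p]) + 1) ≠ 0 := by
    intro h0
    exact hx (by linear_combination h0 / 2)
  obtain ⟨m, hm⟩ : ∃ m, p = leastResidue x + 1 + m := ⟨p - (leastResidue x + 1), by omega⟩
  have htq : (x : ℚ_[p]) - (leastResidue x : ℚ_[p]) = p * (t : ℚ_[p]) := by
    exact_mod_cast congrArg (fun y : ℤ_[p] => (y : ℚ_[p])) ht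
  generalize leastResidue x = r at *
  by_cases hrm : r = m
  · subst hrm
    obtain ⟨c, hc⟩ := sum_sq_of_central hp hm t
    rw [← hx'] at hc
    have hcq := congrArg (fun y : ℤ_[p] => (y : ℚ_[p])) hc
    refine ⟨c, ?_⟩
    have hpq : (p : ℚ_[p]) = r + 1 + r := by exact_mod_cast congrArg (Nat.cast : ℕ → ℚ_[p]) hm
    have hone : ((p : ℚ_[p]) + 2 * ((x : ℚ_[p]) - (r : ℚ_[p]))) / (2 * (x : ℚ_[p]) + 1) = 1 := by
      rw [div_eq_one_iff_eq hne]
      linear_combination hpq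
    rw [hone, mul_one]
    exact_mod_cast hcq
  · obtain ⟨c, hc⟩ := sum_sq_of_ne hp hm hrm t
    obtain ⟨u, hu⟩ := isUnit_two_mul_add_one hm hrm t
    rw [← hx'] at hc hu
    have huv : (2 * x + 1) * (↑u⁻¹ : ℤ_[p]) = 1 := by rw [← hu, Units.mul_inv]
    have hcq := congrArg (fun y : ℤ_[p] => (y : ℚ_[p])) hc
    have huq := congrArg (fun y : ℤ_[p] => (y : ℚ_[p])) huv
    refine ⟨c * (↑u⁻¹ : ℤ_[p]), ?_⟩
    have h2 : ((2 : ℤ_[p]) : ℚ_[p]) = 2 := rfl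
    push_cast [h2] at hcq huq ⊢
    apply mul_left_cancel₀ hne
    rw [htq, mul_sub]
    have hdiv : (2 * (x : ℚ_[p]) + 1) * ((-1) ^ r
        * (((p : ℚ_[p]) + 2 * (p * (t : ℚ_[p]))) / (2 * (x : ℚ_[p]) + 1)))
        = (-1) ^ r * ((p : ℚ_[p]) + 2 * (p * (t : ℚ_[p]))) := by
      field_simp
    rw [hdiv]
    linear_combination hcq - (p : ℚ_[p]) ^ 3 * (c : ℚ_[p]) * huq
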